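/- Let $E$ be a real Banach lattice, with norm dual $E^*$ ordered by $f\le g$ iff $f(x)\le g(x)$ for all $x\in E^+$. A sequence in $E$ or in $E^*$ is called disjoint if $|u_n|\wedge|u_m|=0$ for all $n\neq m$. Assume that $E$ has property (d): for every disjoint weak* null sequence $(f_n)\subset E^*$, the sequence $(|f_n|)$ is weak* null. Call a norm bounded set $A\subset E$ almost limited if $\sup_{x\in A}|f_n(x)|\to 0$ for every disjoint weak* null sequence $(f_n)\subset E^*$, and say that $E$ has the weak Dunford–Pettis* (wDP*) property if $f_n(x_n)\to 0$ for every weakly null sequence $(x_n)\subset E$ and every disjoint weak* null sequence $(f_n)\subset E^*$. The solid hull of $W\subset E$ is $\{y\in E: |y|\le|x| \text{ for some } x\in W\}$. Then the following assertions are equivalent: 1. $E$ has the wDP* property. 2. $f_n(x_n)\to 0$ for every weakly null sequence $(x_n)\subset E^+$ and every disjoint weak* null sequence $(f_n)\subset E^*$. 3. $f_n(x_n)\to 0$ for every disjoint weakly null sequence $(x_n)\subset E$ and every disjoint weak* null sequence $(f_n)\subset E^*$. 4. $f_n(x_n)\to 0$ for every disjoint weakly null sequence $(x_n)\subset E^+$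 and every disjoint weak* null sequence $(f_n)\subset E^*$. 5. The solid hull of every relatively weakly compact subset of $E$ is almost limited. 6. $f_n(x_n)\to 0$ for every weakly null sequence $(x_n)\subset E^+$ and every disjoint weak* null sequence $(f_n)\subset (E^*)^+$. 7. $f_n(x_n)\to 0$ for every disjoint weakly null sequence $(x_n)\subset E^+$ and every disjoint weak* null sequence $(f_n)\subset (E^*)^+$. -/

import Mathlib

open Filter Topology

noncomputable section

namespace BanachLattice

section Dual

set_option linter.unusedSectionVars false

variable {E : Type*} [NormedAddCommGroup E] [NormedSpace ℝ E] [Lattice E]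
  [IsOrderedAddMonoid E] [HasSolidNorm E]

/-- The value of the positive part of `f` at a positive vector `x`:
`sup {f y : 0 ≤ y ≤ x}`. -/
def posVal (f : StrongDual ℝ E) (x : E) : ℝ := sSup (f '' Set.Icc 0 x)

lemma apply_le_of_mem_Icc (f : StrongDual ℝ E) {x y : E} (hy : y ∈ Set.Icc 0 x) :
    f y ≤ ‖f‖ * ‖x‖ := by
  have h1 : ‖y‖ ≤ ‖x‖ := norm_le_norm_of_abs_le_abs (by
    rw [abs_of_nonneg hy.1, abs_of_nonneg (hy.1.trans hy.2)]; exact hy.2)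
  calc f y ≤ ‖f y‖ := Real.le_norm_self _
    _ ≤ ‖f‖ * ‖y‖ := f.le_opNorm y
    _ ≤ ‖f‖ * ‖x‖ := by gcongr

lemma le_posVal (f : StrongDual ℝ E) {x y : E} (h0 : 0 ≤ y) (hy : y ≤ x) :
    f y ≤ posVal f x := by
  refine le_csSup ⟨‖f‖ * ‖x‖, ?_⟩ ⟨y, ⟨h0, hy⟩, rfl⟩
  rintro _ ⟨z, hz, rfl⟩
  exact apply_le_of_mem_Icc f hz

lemma posVal_le (f : StrongDual ℝ E) {x : E} (hx : 0 ≤ x) {c : ℝ}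
    (h : ∀ y, 0 ≤ y → y ≤ x → f y ≤ c) : posVal f x ≤ c := by
  refine csSup_le ⟨f 0, 0, ⟨le_rfl, hx⟩, rfl⟩ ?_
  rintro _ ⟨z, hz, rfl⟩
  exact h z hz.1 hz.2

lemma posVal_nonneg (f : StrongDual ℝ E) {x : E} (hx : 0 ≤ x) : 0 ≤ posVal f x := by
  simpa using le_posVal f le_rfl hx

lemma posVal_add (f : StrongDual ℝ E) {x y : E} (hx : 0 ≤ x) (hy : 0 ≤ y) :
    posVal f (x + y) = posVal f x + posVal f y := by
  apply le_antisymm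
  · refine posVal_le f (add_nonneg hx hy) fun z hz hzxy => ?_
    have h1 : f (z ⊓ x) ≤ posVal f x := le_posVal f (le_inf hz hx) inf_le_right
    have h2 : f (z - z ⊓ x) ≤ posVal f y := by
      refine le_posVal f (sub_nonneg.2 inf_le_left) ?_
      rw [sub_le_iff_le_add', ← sub_le_iff_le_add]
      exact le_inf (sub_le_self z hy) (sub_le_iff_le_add.2 hzxy)
    have h3 : f z = f (z ⊓ x) + f (z - z ⊓ x) := by rw [← map_add]; congr 1; abel
    linarith
  · rw [← le_sub_iff_add_le]
    refine posVal_le f hx fun u hu hux => ?_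
    rw [le_sub_comm]
    refine posVal_le f hy fun v hv hvy => ?_
    have := le_posVal f (add_nonneg hu hv) (add_le_add hux hvy)
    rw [map_add] at this
    linarith

lemma posVal_sub_eq (f : StrongDual ℝ E) {a b c d : E} (ha : 0 ≤ a) (hb : 0 ≤ b)
    (hc : 0 ≤ c) (hd : 0 ≤ d) (h : a - b = c - d) :
    posVal f a - posVal f b = posVal f c - posVal f d := by
  have h' : a + d = c + b := sub_eq_sub_iff_add_eq_add.1 h
  have := congrArg (posVal f) h'
  rw [posVal_add f ha hd, posVal_add f hc hb] at this
  linarith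

/-- The positive part of `f`, as an additive map on `E`. -/
def posPartHom (f : StrongDual ℝ E) : E →+ ℝ where
  toFun x := posVal f x⁺ - posVal f x⁻
  map_zero' := by simp
  map_add' x y := by
    have h := posVal_sub_eq f (posPart_nonneg (x + y)) (negPart_nonneg (x + y))
      (add_nonneg (posPart_nonneg x) (posPart_nonneg y))
      (add_nonneg (negPart_nonneg x) (negPart_nonneg y))
      (by rw [add_sub_add_comm]; simp only [posPart_sub_negPart])
    rw [posVal_add f (posPart_nonneg x) (posPart_nonneg y),
      posVal_add f (negPart_nonneg x) (negPart_nonneg y)] at h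
    rw [h]; ring

lemma posPartHom_bound (f : StrongDual ℝ E) (x : E) : ‖posPartHom f x‖ ≤ ‖f‖ * ‖x‖ := by
  have key : ∀ y : E, 0 ≤ y → y ≤ |x| → posVal f y ≤ ‖f‖ * ‖x‖ := fun y hy hyx =>
    posVal_le f hy fun z hz hzy => by
      simpa only [norm_abs_eq_norm] using apply_le_of_mem_Icc f ⟨hz, hzy.trans hyx⟩
  have h1 := key x⁺ (posPart_nonneg x) (by rw [← posPart_add_negPart x]; simp)
  have h2 := key x⁻ (negPart_nonneg x) (by rw [← posPart_add_negPart x]; simp)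
  have h3 := posVal_nonneg f (posPart_nonneg x)
  have h4 := posVal_nonneg f (negPart_nonneg x)
  rw [Real.norm_eq_abs, abs_le]
  change _ ≤ posVal f x⁺ - posVal f x⁻ ∧ posVal f x⁺ - posVal f x⁻ ≤ _
  constructor <;> linarith

/-- The positive part of a functional `f` in the dual `E*`, given on `x ≥ 0` by
`sup {f y : 0 ≤ y ≤ x}`. -/
def dualPosPart (f : StrongDual ℝ E) : StrongDual ℝ E :=
  (posPartHom f).toRealLinearMap
    (AddMonoidHomClass.continuous_of_bound (posPartHom f) ‖f‖ (posPartHom_bound f))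

lemma dualPosPart_apply (f : StrongDual ℝ E) {x : E} (hx : 0 ≤ x) :
    dualPosPart f x = posVal f x := by
  change posVal f x⁺ - posVal f x⁻ = posVal f x
  rw [posPart_of_nonneg hx, negPart_of_nonneg hx]
  have : posVal f (0 : E) = 0 := by simp [posVal]
  rw [this, sub_zero]

/-- The dual order on `E*` : `f ≤ g` iff `f x ≤ g x` for all `x ≥ 0`. -/
instance dualPartialOrder : PartialOrder (StrongDual ℝ E) where
  le f g := ∀ x : E, 0 ≤ x → f x ≤ g x
  le_refl _ _ _ := le_rfl
  le_trans _ _ _ h₁ h₂ x hx := (h₁ x hx).trans (h₂ x hx)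
  le_antisymm f g h₁ h₂ := by
    have h : ∀ x : E, 0 ≤ x → f x = g x := fun x hx => le_antisymm (h₁ x hx) (h₂ x hx)
    ext x
    rw [← posPart_sub_negPart x, map_sub, map_sub, h _ (posPart_nonneg x),
      h _ (negPart_nonneg x)]

lemma dual_le_iff {f g : StrongDual ℝ E} : f ≤ g ↔ ∀ x : E, 0 ≤ x → f x ≤ g x := Iff.rfl

lemma le_dualPosPart (f : StrongDual ℝ E) : f ≤ dualPosPart f := fun x hx => by
  rw [dualPosPart_apply f hx]; exact le_posVal f hx le_rfl

lemma dualPosPart_nonneg (f : StrongDual ℝ E) : 0 ≤ dualPosPart f := fun x hx => by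
  rw [dualPosPart_apply f hx]; exact posVal_nonneg f hx

lemma dualPosPart_le {f g : StrongDual ℝ E} (hf : f ≤ g) (hg : 0 ≤ g) :
    dualPosPart f ≤ g := fun x hx => by
  rw [dualPosPart_apply f hx]
  refine posVal_le f hx fun y hy hyx => (hf y hy).trans ?_
  have := hg (x - y) (sub_nonneg.2 hyx)
  rw [map_sub g, zero_apply] at this
  linarith

/-- The dual `E*` of a normed lattice is a lattice for the dual order;
`|f|` and `f ⊓ g` in `E*` refer to this structure. -/
instance dualLattice : Lattice (StrongDual ℝ E) where
  __ := dualPartialOrder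
  sup f g := g + dualPosPart (f - g)
  inf f g := f - dualPosPart (f - g)
  le_sup_left f g x hx := by
    have := le_dualPosPart (f - g) x hx
    simp only [sub_apply, add_apply] at this ⊢
    linarith
  le_sup_right f g x hx := by
    have := dualPosPart_nonneg (f - g) x hx
    simp only [zero_apply, add_apply] at this ⊢
    linarith
  sup_le f g h hf hg x hx := by
    have := dualPosPart_le (f := f - g) (g := h - g)
      (fun y hy => by simpa using hf y hy) (fun y hy => by simpa using hg y hy) x hx
    simp only [sub_apply, add_apply] at this ⊢
    linarith
  inf_le_left f g x hx := by
    have := dualPosPart_nonneg (f - g) x hx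
    simp only [zero_apply, sub_apply] at this ⊢
    linarith
  inf_le_right f g x hx := by
    have := le_dualPosPart (f - g) x hx
    simp only [sub_apply] at this ⊢
    linarith
  le_inf h f g hf hg x hx := by
    have := dualPosPart_le (f := f - g) (g := f - h)
      (fun y hy => sub_le_sub_left (hg y hy) (f y)) (fun y hy => by simpa using hf y hy) x hx
    simp only [sub_apply] at this ⊢
    linarith

end Dual

/-- A sequence with pairwise disjoint terms: `|x m| ⊓ |x n| = 0` for `m ≠ n`. -/
def DisjointSeq {L : Type*} [Lattice L] [AddGroup L] (x : ℕ → L) : Prop :=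
  Pairwise fun m n => |x m| ⊓ |x n| = 0

/-- `x n → 0` in the weak topology of `E`. -/
def WeaklyNull {E : Type*} [NormedAddCommGroup E] [NormedSpace ℝ E] (x : ℕ → E) : Prop :=
  Tendsto (fun n => toWeakSpace ℝ E (x n)) atTop (𝓝 0)

/-- `f n → 0` in the weak* topology of `E*`. -/
def WeakStarNull {E : Type*} [NormedAddCommGroup E] [NormedSpace ℝ E]
    (f : ℕ → StrongDual ℝ E) : Prop :=
  Tendsto (fun n => StrongDual.toWeakDual (f n)) atTop (𝓝 0)

/-- The closure of `W` in the weak topology of `E` is weakly compact. -/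
def RelativelyWeaklyCompact {E : Type*} [NormedAddCommGroup E] [NormedSpace ℝ E]
    (W : Set E) : Prop :=
  IsCompact (closure (toWeakSpace ℝ E '' W))

/-- A norm bounded set on which every disjoint weak* null sequence of `E*` converges
uniformly to zero. -/
def AlmostLimited {E : Type*} [NormedAddCommGroup E] [NormedSpace ℝ E] [Lattice E]
    [IsOrderedAddMonoid E] [HasSolidNorm E] (A : Set E) : Prop :=
  Bornology.IsBounded A ∧ ∀ f : ℕ → StrongDual ℝ E, DisjointSeq f → WeakStarNull f →
    TendstoUniformlyOn (fun n x => f n x) (fun _ => 0) atTop A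

/-- The property (d): if `(f n)` is disjoint and weak* null in `E*`, then
`|f n| → 0` weak*. -/
def PropertyD (E : Type*) [NormedAddCommGroup E] [NormedSpace ℝ E] [Lattice E]
    [IsOrderedAddMonoid E] [HasSolidNorm E] : Prop :=
  ∀ f : ℕ → StrongDual ℝ E, DisjointSeq f → WeakStarNull f → WeakStarNull fun n => |f n|

/-- The weak Dunford-Pettis* property. -/
def WeakDPStar (E : Type*) [NormedAddCommGroup E] [NormedSpace ℝ E] [Lattice E]
    [IsOrderedAddMonoid E] [HasSolidNorm E] : Prop :=
  ∀ (x : ℕ → E) (f : ℕ → StrongDual ℝ E), WeaklyNull x → DisjointSeq f → WeakStarNull f →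
    Tendsto (fun n => f n (x n)) atTop (𝓝 0)

end BanachLattice

end

noncomputable section

namespace BanachLattice

/-! ### Disjointness in vector lattices. -/

section Lattice

set_option linter.unusedSectionVars false

variable {E : Type*} [Lattice E] [AddCommGroup E] [IsOrderedAddMonoid E]

/-! Only 7 → 5 and 5 → 1 have content; the other arrows restrict the class of sequences. For 5 → 1,
the range of a weakly null sequence is relatively weakly compact, and uniform convergence on its
solid hull covers the diagonal `f n (x n)`.

For 7 → 5, failure gives, along a subsequence, `w n ∈ W` with `|f n| |w n| ≥ ε`, and property (d)
makes `|f n|` weak* null. Disjointification (`exists_disjoint_of_le_apply`) passes to a further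
subsequence and to disjoint `0 ≤ u k` below the `|w n|` on which `|f n|` stays above `ε / 2`. By
`weaklyNull_of_disjoint_of_le_abs` the `u k` are weakly null, contradicting 7.

The weak nullity rests on a Phillips-type argument. Disjoint `a n` carry components `h n` of a
positive `f` with `∑ h n ≤ f`, so every subseries of `∑ h n` is a continuous functional. Weak
compactness then gives a subsequence along which all subseries converge, and Baire's theorem on the
Cantor space forces `h n (w n) → 0` there (`exists_subseq_tendsto_apply`). Since `f (a n) ≤ h n (w
n)` when `a n ≤ (w n)⁺`, this suffices. -/

lemma add_inf_le_inf_add_inf {x y z : E} (hx : 0 ≤ x) (hy : 0 ≤ y) (hz : 0 ≤ z) :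
    (x + y) ⊓ z ≤ x ⊓ z + y ⊓ z := by
  rw [inf_add, add_inf, add_inf]
  exact le_inf (le_inf inf_le_left (inf_le_right.trans (le_add_of_nonneg_left hx)))
    (le_inf (inf_le_right.trans (le_add_of_nonneg_right hy))
      (inf_le_right.trans (le_add_of_nonneg_left hz)))

lemma add_inf_eq_zero {x y z : E} (hx : 0 ≤ x) (hy : 0 ≤ y) (hz : 0 ≤ z)
    (hxz : x ⊓ z = 0) (hyz : y ⊓ z = 0) : (x + y) ⊓ z = 0 :=
  le_antisymm ((add_inf_le_inf_add_inf hx hy hz).trans_eq (by rw [hxz, hyz, add_zero]))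
    (le_inf (add_nonneg hx hy) hz)

lemma inf_eq_zero_of_le {x y a b : E} (hx : 0 ≤ x) (hy : 0 ≤ y) (hxa : x ≤ a) (hyb : y ≤ b)
    (h : a ⊓ b = 0) : x ⊓ y = 0 :=
  le_antisymm ((inf_le_inf hxa hyb).trans_eq h) (le_inf hx hy)

lemma nsmul_inf_eq_zero {x y : E} (hx : 0 ≤ x) (hy : 0 ≤ y) (h : x ⊓ y = 0) (k : ℕ) :
    (k • x) ⊓ y = 0 := by
  induction k with
  | zero => simp [hy]
  | succ k ih => rw [succ_nsmul]; exact add_inf_eq_zero (nsmul_nonneg hx k) hx hy ih h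

lemma nsmul_inf_nsmul_eq_zero {x y : E} (hx : 0 ≤ x) (hy : 0 ≤ y) (h : x ⊓ y = 0) (k l : ℕ) :
    (k • x) ⊓ (l • y) = 0 := by
  rw [inf_comm]
  refine nsmul_inf_eq_zero hy (nsmul_nonneg hx k) ?_ l
  rw [inf_comm]
  exact nsmul_inf_eq_zero hx hy h k

lemma add_eq_sup_of_inf_eq_zero {x y : E} (h : x ⊓ y = 0) : x + y = x ⊔ y := by
  rw [← inf_add_sup, h, zero_add]

lemma sum_inf_eq_zero {ι : Type*} (s : Finset ι) {u : ι → E} {v : E} (hu : ∀ i, 0 ≤ u i)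
    (hv : 0 ≤ v) (h : ∀ i ∈ s, u i ⊓ v = 0) : (∑ i ∈ s, u i) ⊓ v = 0 := by
  classical
  induction s using Finset.induction_on with
  | empty => simp [hv]
  | insert i s hi ih =>
    rw [Finset.sum_insert hi]
    exact add_inf_eq_zero (hu i) (Finset.sum_nonneg fun j _ => hu j) hv
      (h i (Finset.mem_insert_self i s)) (ih fun j hj => h j (Finset.mem_insert_of_mem hj))

/-- A finite sum of pairwise disjoint positive vectors, all below `y`, is below `y`. -/
lemma sum_le_of_disjoint {ι : Type*} (s : Finset ι) {u : ι → E} {y : E} (hu : ∀ i, 0 ≤ u i)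
    (hy : 0 ≤ y) (huy : ∀ i, u i ≤ y) (h : Pairwise fun i j => u i ⊓ u j = 0) :
    ∑ i ∈ s, u i ≤ y := by
  classical
  induction s using Finset.induction_on with
  | empty => simpa using hy
  | insert i s hi ih =>
    have : (∑ j ∈ s, u j) ⊓ u i = 0 :=
      sum_inf_eq_zero s hu (hu i) fun j hj => h fun hji => hi (hji ▸ hj)
    rw [Finset.sum_insert hi, add_comm, add_eq_sup_of_inf_eq_zero this]
    exact sup_le ih (huy i)

end Lattice

/-! ### Positive functionals and their components. -/

section Functional

set_option linter.unusedSectionVars false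

variable {E : Type*} [NormedAddCommGroup E] [NormedSpace ℝ E] [Lattice E]
  [IsOrderedAddMonoid E] [HasSolidNorm E]

lemma weaklyNull_iff {x : ℕ → E} :
    WeaklyNull x ↔ ∀ f : StrongDual ℝ E, Tendsto (fun n => f (x n)) atTop (𝓝 0) := by
  unfold WeaklyNull
  have hind : IsInducing fun (y : WeakSpace ℝ E) (f : StrongDual ℝ E) =>
      f ((toWeakSpace ℝ E).symm y) := ⟨rfl⟩
  rw [hind.tendsto_nhds_iff, tendsto_pi_nhds]
  simp

lemma weakStarNull_iff {f : ℕ → StrongDual ℝ E} :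
    WeakStarNull f ↔ ∀ x : E, Tendsto (fun n => f n x) atTop (𝓝 0) := by
  unfold WeakStarNull
  rw [tendsto_iff_forall_eval_tendsto_topDualPairing]
  rfl

lemma continuous_apply_toWeakSpace_symm (f : StrongDual ℝ E) :
    Continuous fun y : WeakSpace ℝ E => f ((toWeakSpace ℝ E).symm y) :=
  WeakBilin.eval_continuous (topDualPairing ℝ E).flip f

lemma monotone_apply {f : StrongDual ℝ E} (hf : 0 ≤ f) {x y : E} (h : x ≤ y) : f x ≤ f y := by
  have := hf (y - x) (sub_nonneg.2 h)
  rw [map_sub f, zero_apply] at this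
  linarith

lemma apply_nonneg {f : StrongDual ℝ E} (hf : 0 ≤ f) {x : E} (h : 0 ≤ x) : 0 ≤ f x := by
  simpa using monotone_apply hf h

lemma abs_apply_le {f : StrongDual ℝ E} (hf : 0 ≤ f) (x : E) : |f x| ≤ f |x| := by
  rw [abs_le']
  refine ⟨monotone_apply hf (le_abs_self x), ?_⟩
  rw [← map_neg]
  exact monotone_apply hf (neg_le_abs x)

/-- An additive, nonnegative and norm bounded function on the positive cone extends to a
continuous linear functional. -/
lemma exists_dual_extension (c : E → ℝ) (C : ℝ)
    (hadd : ∀ x y, 0 ≤ x → 0 ≤ y → c (x + y) = c x + c y) (h0 : ∀ x, 0 ≤ x → 0 ≤ c x)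
    (hC : ∀ x, 0 ≤ x → c x ≤ C * ‖x‖) :
    ∃ g : StrongDual ℝ E, ∀ x, 0 ≤ x → g x = c x := by
  have hz : c 0 = 0 := by simpa using hadd 0 0 le_rfl le_rfl
  let φ : E →+ ℝ :=
    { toFun := fun x => c x⁺ - c x⁻
      map_zero' := by simp
      map_add' := fun x y => by
        have h : (x + y)⁺ + (x⁻ + y⁻) = x⁺ + y⁺ + (x + y)⁻ := by
          rw [← sub_eq_sub_iff_add_eq_add, posPart_sub_negPart, add_sub_add_comm,
            posPart_sub_negPart, posPart_sub_negPart]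
        have h' := congrArg c h
        rw [hadd _ _ (posPart_nonneg _) (add_nonneg (negPart_nonneg x) (negPart_nonneg y)),
          hadd _ _ (add_nonneg (posPart_nonneg x) (posPart_nonneg y)) (negPart_nonneg _),
          hadd _ _ (negPart_nonneg x) (negPart_nonneg y),
          hadd _ _ (posPart_nonneg x) (posPart_nonneg y)] at h'
        linarith }
  have hmono : ∀ x y : E, 0 ≤ x → x ≤ y → c x ≤ c y := fun x y hx hxy => by
    have h1 := hadd x (y - x) hx (sub_nonneg.2 hxy)
    have h2 := h0 (y - x) (sub_nonneg.2 hxy)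
    rw [add_sub_cancel] at h1
    linarith
  have hφ : ∀ x, ‖φ x‖ ≤ C * ‖x‖ := fun x => by
    have h1 := hmono x⁺ |x| (posPart_nonneg x) (by rw [← posPart_add_negPart x]; simp)
    have h2 := hmono x⁻ |x| (negPart_nonneg x) (by rw [← posPart_add_negPart x]; simp)
    have h3 := h0 _ (posPart_nonneg x)
    have h4 := h0 _ (negPart_nonneg x)
    have h5 := hC _ (abs_nonneg x)
    rw [norm_abs_eq_norm] at h5
    rw [Real.norm_eq_abs, abs_le]
    change _ ≤ c x⁺ - c x⁻ ∧ c x⁺ - c x⁻ ≤ _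
    constructor <;> linarith
  refine ⟨φ.toRealLinearMap (AddMonoidHomClass.continuous_of_bound φ C hφ), fun x hx => ?_⟩
  change c x⁺ - c x⁻ = c x
  rw [posPart_of_nonneg hx, negPart_of_nonneg hx, hz, sub_zero]

/-- The component of a positive functional `f` carried by a positive vector `a`. -/
lemma exists_component {f : StrongDual ℝ E} (hf : 0 ≤ f) {a : E} (ha : 0 ≤ a) :
    ∃ g : StrongDual ℝ E, ∀ y, 0 ≤ y →
      Tendsto (fun k : ℕ => f (y ⊓ k • a)) atTop (𝓝 (g y)) := by
  have hlim : ∀ y, 0 ≤ y → Tendsto (fun k : ℕ => f (y ⊓ k • a)) atTop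
      (𝓝 (⨆ k : ℕ, f (y ⊓ k • a))) := fun y hy => by
    refine tendsto_atTop_ciSup (fun k l hkl => monotone_apply hf
      (inf_le_inf_left y (nsmul_le_nsmul_left ha hkl))) ⟨f y, ?_⟩
    rintro _ ⟨k, rfl⟩
    exact monotone_apply hf inf_le_left
  suffices ∃ g : StrongDual ℝ E, ∀ y, 0 ≤ y → g y = ⨆ k : ℕ, f (y ⊓ k • a) by
    obtain ⟨g, hg⟩ := this
    exact ⟨g, fun y hy => by rw [hg y hy]; exact hlim y hy⟩
  refine exists_dual_extension (fun y => ⨆ k : ℕ, f (y ⊓ k • a)) ‖f‖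
    (fun x y hx hy => ?_) (fun x hx => ?_) (fun x hx => ?_)
  · apply le_antisymm
    · refine le_of_tendsto_of_tendsto' (hlim _ (add_nonneg hx hy))
        ((hlim x hx).add (hlim y hy)) fun k => ?_
      rw [← map_add]
      exact monotone_apply hf (add_inf_le_inf_add_inf hx hy (nsmul_nonneg ha k))
    -- Superadditivity costs a doubled multiple of `a`, so the limit for `x + y` is taken along `k +
    -- k`.
    · refine le_of_tendsto_of_tendsto' ((hlim x hx).add (hlim y hy))
        ((hlim _ (add_nonneg hx hy)).comp (tendsto_atTop_mono (fun k => Nat.le_add_left k k) tendsto_id)) fun k => ?_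
      rw [← map_add]
      refine monotone_apply hf (le_inf (add_le_add inf_le_left inf_le_left) ?_)
      simp only [add_nsmul]
      exact add_le_add inf_le_right inf_le_right
  · exact ge_of_tendsto' (hlim x hx) fun k =>
      apply_nonneg hf (le_inf hx (nsmul_nonneg ha k))
  · refine le_of_tendsto' (hlim x hx) fun k => (monotone_apply hf inf_le_left).trans ?_
    exact apply_le_of_mem_Icc f ⟨hx, le_rfl⟩

/-- Disjoint positive vectors carry components of a positive functional with total at most `f`. -/
lemma exists_disjoint_components {f : StrongDual ℝ E} (hf : 0 ≤ f) {a : ℕ → E}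
    (ha : ∀ n, 0 ≤ a n) (hd : Pairwise fun m n => a m ⊓ a n = 0) :
    ∃ h : ℕ → StrongDual ℝ E, (∀ n, 0 ≤ h n) ∧
      (∀ (s : Finset ℕ) (y : E), 0 ≤ y → ∑ n ∈ s, h n y ≤ f y) ∧
      ∀ n w, a n ≤ w⁺ → f (a n) ≤ h n w := by
  choose h hh using fun n => exists_component hf (ha n)
  refine ⟨h, fun n y hy => ?_, fun s y hy => ?_, fun n w hw => ?_⟩
  · exact ge_of_tendsto' (hh n y hy) fun k =>
      apply_nonneg hf (le_inf hy (nsmul_nonneg (ha n) k))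
  · refine le_of_tendsto' (tendsto_finsetSum s fun n _ => hh n y hy) fun k => ?_
    rw [← map_sum]
    refine monotone_apply hf (sum_le_of_disjoint s
      (fun n => le_inf hy (nsmul_nonneg (ha n) k)) hy (fun n => inf_le_left) fun m n hmn => ?_)
    exact inf_eq_zero_of_le (le_inf hy (nsmul_nonneg (ha m) k))
      (le_inf hy (nsmul_nonneg (ha n) k)) inf_le_right inf_le_right
      (nsmul_inf_nsmul_eq_zero (ha m) (ha n) (hd hmn) k k)
  · have h1 : f (a n) ≤ h n w⁺ := by
      refine ge_of_tendsto (hh n w⁺ (posPart_nonneg w)) ?_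
      filter_upwards [eventually_ge_atTop 1] with k hk
      refine monotone_apply hf (le_inf hw ?_)
      simpa using nsmul_le_nsmul_left (ha n) hk
    -- As `a n ≤ w⁺`, `a n` is disjoint from `w⁻`, so its component vanishes there and `h n w = h n
    -- w⁺`.
    have h2 : h n w⁻ = 0 := by
      refine tendsto_nhds_unique (hh n w⁻ (negPart_nonneg w)) ?_
      have : ∀ k : ℕ, w⁻ ⊓ k • a n = 0 := fun k => by
        rw [inf_comm]
        refine nsmul_inf_eq_zero (ha n) (negPart_nonneg w) ?_ k
        exact inf_eq_zero_of_le (ha n) (negPart_nonneg w) hw le_rfl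
          (posPart_inf_negPart_eq_zero w)
      simp [this]
    rw [← posPart_sub_negPart w, map_sub, h2, sub_zero]
    exact h1

end Functional

/-! ### Disjoint sequences in solid hulls of weakly compact sets. -/

section WeakCompact

set_option linter.unusedSectionVars false

variable {E : Type*} [NormedAddCommGroup E] [NormedSpace ℝ E] [Lattice E]
  [IsOrderedAddMonoid E] [HasSolidNorm E]

lemma summable_abs_apply {f : StrongDual ℝ E} {h : ℕ → StrongDual ℝ E}
    (h0 : ∀ n, 0 ≤ h n) (hs : ∀ (s : Finset ℕ) (y : E), 0 ≤ y → ∑ n ∈ s, h n y ≤ f y) (y : E) :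
    Summable fun n => |h n y| :=
  summable_of_sum_le (c := f |y|) (fun _ => abs_nonneg _) fun s =>
    (Finset.sum_le_sum fun n _ => abs_apply_le (h0 n) y).trans (hs s |y| (abs_nonneg y))

lemma abs_ite_le (b : Bool) (r : ℝ) : |if b then r else 0| ≤ |r| := by
  cases b <;> simp

/-- Domination of the partial sums by `f` makes each subseries positive and bounded by `‖f‖` on the
cone. Coding subsets by `ℕ → Bool` prepares for Baire's theorem. -/
lemma exists_subseries {f : StrongDual ℝ E} {h : ℕ → StrongDual ℝ E}
    (h0 : ∀ n, 0 ≤ h n) (hs : ∀ (s : Finset ℕ) (y : E), 0 ≤ y → ∑ n ∈ s, h n y ≤ f y)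
    (θ : ℕ → Bool) :
    ∃ φ : StrongDual ℝ E, ∀ y, φ y = ∑' n, if θ n then h n y else 0 := by
  have hsum : ∀ y, Summable fun n => if θ n then h n y else 0 := fun y =>
    .of_abs (.of_nonneg_of_le (fun n => abs_nonneg _) (fun n => abs_ite_le (θ n) _)
      (summable_abs_apply h0 hs y))
  have hadd : ∀ x y, ∑' n, (if θ n then h n (x + y) else 0) =
      ∑' n, (if θ n then h n x else 0) + ∑' n, (if θ n then h n y else 0) := fun x y => by
    rw [← (hsum x).tsum_add (hsum y)]
    refine tsum_congr fun n => ?_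
    split_ifs <;> simp
  obtain ⟨φ, hφ⟩ := exists_dual_extension (fun y : E => ∑' n, if θ n then h n y else 0) ‖f‖
    (fun x y _ _ => hadd x y)
    (fun x hx => tsum_nonneg fun n => by split_ifs; exacts [apply_nonneg (h0 n) hx, le_rfl])
    (fun x hx => ((hsum x).tsum_le_of_sum_le fun s => (Finset.sum_le_sum fun n _ => by
      split_ifs; exacts [le_rfl, apply_nonneg (h0 n) hx]).trans (hs s x hx)).trans
        (apply_le_of_mem_Icc f ⟨hx, le_rfl⟩))
  refine ⟨φ, fun y => ?_⟩
  -- The formula is known only on the cone; additivity at `y + y⁻ = y⁺` transfers it to `y`.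
  have h1 := hadd y y⁻
  rw [show y + y⁻ = y⁺ from (eq_add_of_sub_eq (posPart_sub_negPart y)).symm] at h1
  rw [← posPart_sub_negPart y, map_sub, hφ _ (posPart_nonneg y), hφ _ (negPart_nonneg y),
    posPart_sub_negPart y]
  linarith

/-- If all subseries of `∑ m, c n m` tend to zero as `n → ∞`, then so does `c n (ψ n)` for
`ψ` strictly increasing. -/
lemma tendsto_diagonal_of_tendsto_subseries {c : ℕ → ℕ → ℝ} (hc : ∀ n, Summable fun m => |c n m|)
    {ψ : ℕ → ℕ} (hψ : StrictMono ψ)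
    (h : ∀ θ : ℕ → Bool, Tendsto (fun n => ∑' m, if θ m then c n m else 0) atTop (𝓝 0)) :
    Tendsto (fun n => c n (ψ n)) atTop (𝓝 0) := by
  have hcont : ∀ n, Continuous fun θ : ℕ → Bool => ∑' m, if θ m then c n m else 0 := fun n =>
    continuous_tsum
      (fun m => (continuous_of_discreteTopology (f := fun b : Bool => if b then c n m else 0)).comp
        (continuous_apply m)) (hc n) fun m θ => abs_ite_le _ _
  have hsum : ∀ n (θ : ℕ → Bool), Summable fun m => if θ m then c n m else 0 := fun n θ =>
    .of_abs (.of_nonneg_of_le (fun m => abs_nonneg _) (fun m => abs_ite_le (θ m) _) (hc n))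
  rw [Metric.tendsto_atTop]
  intro ε hε
  -- By Baire some `F N` contains a basic open set, which restricts only the finitely many
  -- coordinates in `I`. For large `n`, `ψ n ≥ n > M` is a free coordinate; switching it changes the
  -- sum by `c n (ψ n)`, whence a bound `2 * ε / 3`.
  let F : ℕ → Set (ℕ → Bool) := fun N => {θ | ∀ n ≥ N, |∑' m, if θ m then c n m else 0| ≤ ε / 3}
  have hF : ∀ N, IsClosed (F N) := fun N => by
    simp only [F, Set.ofPred_forall]
    exact isClosed_iInter fun n => isClosed_iInter fun _ =>
      isClosed_le (hcont n).abs continuous_const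
  have hU : ⋃ N, F N = Set.univ := by
    refine Set.eq_univ_of_forall fun θ => Set.mem_iUnion.2 ?_
    obtain ⟨N, hN⟩ := Metric.tendsto_atTop.1 (h θ) (ε / 3) (by positivity)
    exact ⟨N, fun n hn => by simpa using (hN n hn).le⟩
  obtain ⟨N, θ, hθ⟩ := nonempty_interior_of_iUnion_of_closed hF hU
  obtain ⟨I, u, hu, hIu⟩ := isOpen_pi_iff.1 isOpen_interior θ hθ
  obtain ⟨M, hM⟩ := I.bddAbove
  refine ⟨max N (M + 1), fun n hn => ?_⟩
  have hnI : ψ n ∉ I := fun hnI => by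
    have h1 := hM (Finset.mem_coe.2 hnI)
    have h2 := (le_max_right N (M + 1)).trans hn
    have h3 := hψ.le_apply (x := n)
    omega
  have hmem : ∀ b, Function.update θ (ψ n) b ∈ F N := fun b => by
    refine interior_subset (hIu fun i hi => ?_)
    have hin : i ≠ ψ n := fun hin => hnI (hin ▸ Finset.mem_coe.1 hi)
    rw [Function.update_of_ne hin]
    exact (hu i hi).2
  have hnN := (le_max_left N (M + 1)).trans hn
  have h1 := hmem true n hnN
  have h2 := hmem false n hnN
  have h3 : (∑' m, if Function.update θ (ψ n) true m then c n m else 0) -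
      (∑' m, if Function.update θ (ψ n) false m then c n m else 0) = c n (ψ n) := by
    rw [← (hsum n _).tsum_sub (hsum n _), tsum_eq_single (ψ n)]
    · simp
    · intro m hm
      simp [Function.update_of_ne hm]
  rw [Real.dist_eq, sub_zero, ← h3]
  rw [abs_le] at h1 h2
  rw [abs_lt]
  constructor <;> linarith

/-- On a weakly compact set, positive functionals with dominated partial sums converge to zero
along the diagonal of any sequence, up to a subsequence. -/
lemma exists_subseq_tendsto_apply {K : Set (WeakSpace ℝ E)} (hK : IsCompact K) {w : ℕ → E}
    (hw : ∀ n, toWeakSpace ℝ E (w n) ∈ K) {f : StrongDual ℝ E} {h : ℕ → StrongDual ℝ E}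
    (h0 : ∀ n, 0 ≤ h n) (hs : ∀ (s : Finset ℕ) (y : E), 0 ≤ y → ∑ n ∈ s, h n y ≤ f y) :
    ∃ ψ : ℕ → ℕ, StrictMono ψ ∧ Tendsto (fun n => h (ψ n) (w (ψ n))) atTop (𝓝 0) := by
  -- The countable product is metrizable, so the compact image of `K` is sequentially compact.
  let T : WeakSpace ℝ E → ℕ → ℝ := fun y m => h m ((toWeakSpace ℝ E).symm y)
  have hT : Continuous T := continuous_pi fun m => continuous_apply_toWeakSpace_symm (h m)
  obtain ⟨_, ⟨y, hyK, rfl⟩, ψ, hψ, hlim⟩ := (hK.image hT).tendsto_subseq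
    (x := fun n => T (toWeakSpace ℝ E (w n))) fun n => Set.mem_image_of_mem T (hw n)
  obtain ⟨v, rfl⟩ := (toWeakSpace ℝ E).surjective y
  have hθ : ∀ θ : ℕ → Bool, Tendsto
      (fun n => ∑' m, if θ m then h m (w (ψ n)) else 0) atTop
      (𝓝 (∑' m, if θ m then h m v else 0)) := fun θ => by
    obtain ⟨φ, hφ⟩ := exists_subseries h0 hs θ
    -- `φ` is determined by `T`, so the only cluster point in the compact image of `S` is `S v`;
    -- hence `φ` converges along the same `ψ`, whatever `θ` is.
    let S : WeakSpace ℝ E → (ℕ → ℝ) × ℝ := fun y => (T y, φ ((toWeakSpace ℝ E).symm y))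
    have hS : Continuous S := hT.prodMk (continuous_apply_toWeakSpace_symm φ)
    have key : Tendsto (fun n => S (toWeakSpace ℝ E (w (ψ n)))) atTop
        (𝓝 (S (toWeakSpace ℝ E v))) := by
      refine (hK.image hS).tendsto_nhds_of_unique_mapClusterPt
        (.of_forall fun n => Set.mem_image_of_mem S (hw (ψ n))) ?_
      rintro _ ⟨y, -, rfl⟩ hcl
      have h1 : MapClusterPt (T y) atTop fun n => T (toWeakSpace ℝ E (w (ψ n))) :=
        MapClusterPt.continuousAt_comp (f := Prod.fst) continuous_fst.continuousAt hcl
      obtain ⟨χ, hχ, hχlim⟩ := h1.tendsto_subseq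
      have h2 : T y = T (toWeakSpace ℝ E v) :=
        tendsto_nhds_unique hχlim (hlim.comp hχ.tendsto_atTop)
      refine Prod.ext h2 ?_
      change φ _ = φ _
      rw [hφ, hφ]
      exact tsum_congr fun m => by rw [show h m _ = h m _ from congrFun h2 m]
    have := (continuous_snd.tendsto _).comp key
    simpa [S, hφ, Function.comp_def] using this
  have hsum := fun (θ : ℕ → Bool) (y : E) => Summable.of_abs
    (.of_nonneg_of_le (fun n => abs_nonneg _) (fun n => abs_ite_le (θ n) _)
      (summable_abs_apply h0 hs y))
  have hdiag := tendsto_diagonal_of_tendsto_subseries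
    (c := fun n m => h m (w (ψ n)) - h m v) (fun n => by
      simpa only [map_sub] using summable_abs_apply h0 hs (w (ψ n) - v)) hψ fun θ => by
    have := (hθ θ).sub_const (∑' m, if θ m then h m v else 0)
    rw [sub_self] at this
    refine this.congr fun n => ?_
    rw [← (hsum θ _).tsum_sub (hsum θ _)]
    refine tsum_congr fun m => ?_
    split_ifs <;> simp
  have hv : Tendsto (fun n => h (ψ n) v) atTop (𝓝 0) :=
    (summable_abs_apply h0 hs v).of_abs.tendsto_atTop_zero.comp hψ.tendsto_atTop
  exact ⟨ψ, hψ, by simpa using hdiag.add hv⟩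

/-- Disjoint positive vectors below the positive parts of vectors in a weakly compact set. -/
lemma tendsto_apply_of_le_posPart {K : Set (WeakSpace ℝ E)} (hK : IsCompact K) {w a : ℕ → E}
    (hw : ∀ n, toWeakSpace ℝ E (w n) ∈ K) (ha : ∀ n, 0 ≤ a n) (haw : ∀ n, a n ≤ (w n)⁺)
    (hd : Pairwise fun m n => a m ⊓ a n = 0) {f : StrongDual ℝ E} (hf : 0 ≤ f) :
    Tendsto (fun n => f (a n)) atTop (𝓝 0) := by
  refine tendsto_of_subseq_tendsto fun ns hns => ?_
  -- Injective reindexing preserves disjointness.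
  obtain ⟨χ, -, hχ⟩ := strictMono_subseq_of_tendsto_atTop hns
  have hd' : Pairwise fun m n => a (ns (χ m)) ⊓ a (ns (χ n)) = 0 := fun m n hmn =>
    hd (hχ.injective.ne hmn)
  obtain ⟨h, h0, hs, hh⟩ := exists_disjoint_components hf (fun n => ha (ns (χ n))) hd'
  obtain ⟨ψ, -, hlim⟩ := exists_subseq_tendsto_apply hK (fun n => hw (ns (χ n))) h0 hs
  exact ⟨fun n => χ (ψ n), squeeze_zero (fun n => apply_nonneg hf (ha _))
    (fun n => hh _ _ (haw _)) hlim⟩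

/-- A disjoint positive sequence in the solid hull of a weakly compact set is weakly null. -/
lemma weaklyNull_of_disjoint_of_le_abs {K : Set (WeakSpace ℝ E)} (hK : IsCompact K) {w u : ℕ → E}
    (hw : ∀ n, toWeakSpace ℝ E (w n) ∈ K) (hu : ∀ n, 0 ≤ u n) (huw : ∀ n, u n ≤ |w n|)
    (hd : Pairwise fun m n => u m ⊓ u n = 0) : WeaklyNull u := by
  have hpos : ∀ f : StrongDual ℝ E, 0 ≤ f → Tendsto (fun n => f (u n)) atTop (𝓝 0) := by
    intro f hf
    have key : ∀ p : ℕ → E, (∀ n, 0 ≤ p n) → Pairwise fun m n => (u m ⊓ p m) ⊓ (u n ⊓ p n) = 0 :=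
      fun p hp m n hmn => inf_eq_zero_of_le (le_inf (hu m) (hp m)) (le_inf (hu n) (hp n))
        inf_le_left inf_le_left (hd hmn)
    have h1 := tendsto_apply_of_le_posPart hK hw (a := fun n => u n ⊓ (w n)⁺)
      (fun n => le_inf (hu n) (posPart_nonneg _)) (fun n => inf_le_right)
      (key _ fun n => posPart_nonneg _) hf
    -- `(w n)⁻` is the positive part of `- w n`, which lies in the compact set `-K`.
    have h2 := tendsto_apply_of_le_posPart hK.neg (w := fun n => - w n)
      (a := fun n => u n ⊓ (w n)⁻)
      (fun n => by simpa using hw n) (fun n => le_inf (hu n) (negPart_nonneg _))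
      (fun n => by rw [posPart_neg]; exact inf_le_right) (key _ fun n => negPart_nonneg _) hf
    refine squeeze_zero (fun n => apply_nonneg hf (hu n)) (fun n => ?_) (by simpa using h1.add h2)
    rw [← map_add]
    refine monotone_apply hf ?_
    have h3 := add_inf_le_inf_add_inf (posPart_nonneg (w n)) (negPart_nonneg (w n)) (hu n)
    rw [posPart_add_negPart, inf_eq_right.2 (huw n)] at h3
    simpa only [inf_comm] using h3
  rw [weaklyNull_iff]
  intro f
  have h1 := hpos _ (dualPosPart_nonneg f)
  have h2 := hpos (dualPosPart f - f) fun x hx => by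
    simpa using le_dualPosPart f x hx
  simpa using h1.sub h2

end WeakCompact

/-! ### The dual order and reindexing of sequences. -/

section Dual

set_option linter.unusedSectionVars false

variable {E : Type*} [NormedAddCommGroup E] [NormedSpace ℝ E] [Lattice E]
  [IsOrderedAddMonoid E] [HasSolidNorm E]

instance : IsOrderedAddMonoid (StrongDual ℝ E) where
  add_le_add_left f g h k x hx := by
    have := h x hx
    simp only [add_apply]
    linarith

lemma abs_apply_le_abs_apply_abs (f : StrongDual ℝ E) (x : E) : |f x| ≤ |f| |x| := by
  have h1 : ∀ y, 0 ≤ y → f y ≤ |f| y := le_abs_self f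
  have h2 : ∀ y, 0 ≤ y → -f y ≤ |f| y := neg_le_abs f
  have h3 : f x = f x⁺ - f x⁻ := by rw [← map_sub, posPart_sub_negPart]
  have h4 : |f| |x| = |f| x⁺ + |f| x⁻ := by rw [← map_add, posPart_add_negPart]
  rw [h3, h4, abs_le]
  have h5 := h1 _ (posPart_nonneg x)
  have h6 := h1 _ (negPart_nonneg x)
  have h7 := h2 _ (posPart_nonneg x)
  have h8 := h2 _ (negPart_nonneg x)
  constructor <;> linarith

lemma DisjointSeq.abs {L : Type*} [Lattice L] [AddCommGroup L] [IsOrderedAddMonoid L]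
    {f : ℕ → L} (h : DisjointSeq f) : DisjointSeq fun n => |f n| := fun _ _ hmn => by
  simpa only [abs_abs] using h hmn

lemma DisjointSeq.comp {L : Type*} [Lattice L] [AddGroup L] {f : ℕ → L} (h : DisjointSeq f)
    {ψ : ℕ → ℕ} (hψ : Function.Injective ψ) : DisjointSeq fun n => f (ψ n) := fun _ _ hmn =>
  h (hψ.ne hmn)

lemma DisjointSeq.of_nonneg {L : Type*} [Lattice L] [AddCommGroup L] [IsOrderedAddMonoid L]
    {f : ℕ → L} (h0 : ∀ n, 0 ≤ f n) (h : Pairwise fun m n => f m ⊓ f n = 0) :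
    DisjointSeq f := fun m n hmn => by
  beta_reduce
  rw [abs_of_nonneg (h0 m), abs_of_nonneg (h0 n)]
  exact h hmn

lemma WeakStarNull.comp {f : ℕ → StrongDual ℝ E} (h : WeakStarNull f) {ψ : ℕ → ℕ}
    (hψ : Tendsto ψ atTop atTop) : WeakStarNull fun n => f (ψ n) :=
  show Tendsto _ _ _ from Tendsto.comp (g := fun n => StrongDual.toWeakDual (f n)) h hψ

end Dual

/-! ### Relatively weakly compact sets. -/

section Compact

variable {E : Type*} [NormedAddCommGroup E] [NormedSpace ℝ E]

/-- Each functional is bounded on the compact closure; the uniform boundedness principle, applied to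
`W` inside the bidual, gives a norm bound. -/
lemma RelativelyWeaklyCompact.exists_norm_le {W : Set E} (hW : RelativelyWeaklyCompact W) :
    ∃ C, ∀ x ∈ W, ‖x‖ ≤ C := by
  obtain ⟨C, hC⟩ := banach_steinhaus
    (g := fun x : W => NormedSpace.inclusionInDoubleDual ℝ E x) fun f => by
      have hf : Continuous fun y : WeakSpace ℝ E => f ((toWeakSpace ℝ E).symm y) :=
        WeakBilin.eval_continuous (topDualPairing ℝ E).flip f
      obtain ⟨C, hC⟩ := (hW.image hf).isBounded.exists_norm_le
      exact ⟨C, fun x => hC _ ⟨toWeakSpace ℝ E x,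
        subset_closure (Set.mem_image_of_mem _ x.2), by simp⟩⟩
  refine ⟨C, fun x hx => ?_⟩
  rw [← (NormedSpace.inclusionInDoubleDualLi (𝕜 := ℝ) (E := E)).norm_map x]
  exact hC ⟨x, hx⟩

/-- Needed so that a subset of a weakly compact set has weakly compact closure. -/
instance : T2Space (WeakSpace ℝ E) := by
  have h := NormedSpace.isEmbedding_inclusionInDoubleDualWeak ℝ E
  exact h.t2Space

lemma WeaklyNull.relativelyWeaklyCompact_range {x : ℕ → E} (hx : WeaklyNull x) :
    RelativelyWeaklyCompact (Set.range x) := by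
  refine (Tendsto.isCompact_insert_range hx).closure_of_subset ?_
  rintro _ ⟨_, ⟨n, rfl⟩, rfl⟩
  exact Or.inr ⟨n, rfl⟩

end Compact

/-! ### Disjointification. -/

section Disjointification

variable {E : Type*} [NormedAddCommGroup E] [NormedSpace ℝ E] [Lattice E]
  [IsOrderedAddMonoid E] [IsOrderedModule ℝ E]

/-- With `x = c • a - b`, the two terms are dominated by `c⁻¹ • x⁺` and `x⁻`, and scaling preserves
the disjointness of `x⁺` and `x⁻`. -/
lemma posPart_sub_smul_inf_eq_zero (a b : E) {c : ℝ} (hc : 0 < c) :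
    (a - c⁻¹ • b)⁺ ⊓ (b - c • a)⁺ = 0 := by
  have hle : ∀ d : ℝ, 0 ≤ d → ∀ x : E, d • x⁺ ⊓ x⁻ = 0 := fun d hd x => by
    obtain ⟨k, hk⟩ := exists_nat_ge d
    refine inf_eq_zero_of_le (smul_nonneg hd (posPart_nonneg x)) (negPart_nonneg x) ?_ le_rfl
      (nsmul_inf_eq_zero (posPart_nonneg x) (negPart_nonneg x) (posPart_inf_negPart_eq_zero x) k)
    rw [← Nat.cast_smul_eq_nsmul ℝ]
    exact smul_le_smul_of_nonneg_right hk (posPart_nonneg x)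
  refine inf_eq_zero_of_le (posPart_nonneg _) (posPart_nonneg _) ?_ ?_
    (hle c⁻¹ (inv_nonneg.2 hc.le) (c • a - b))
  · refine sup_le ?_ (smul_nonneg (inv_nonneg.2 hc.le) (posPart_nonneg _))
    have := smul_le_smul_of_nonneg_left (le_posPart (c • a - b)) (inv_nonneg.2 hc.le)
    rwa [smul_sub, inv_smul_smul₀ hc.ne'] at this
  · rw [← posPart_neg, neg_sub]

/-- Disjointification: removing from `v (k + 1)` a large multiple of the preceding terms and a
small multiple of all terms makes the positive parts disjoint. -/
lemma disjoint_posPart_sub {v z : ℕ → E} {w : E} (hv : ∀ k, (2⁻¹ ^ k : ℝ) • v k ≤ w)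
    (hz0 : ∀ k, 0 ≤ z k) (hw : 0 ≤ w) (hz : ∀ i k, i ≤ k → v i ≤ z k) :
    Pairwise fun k l => (v (k + 1) - (4 ^ k : ℝ) • z k - (2⁻¹ ^ k : ℝ) • w)⁺ ⊓
      (v (l + 1) - (4 ^ l : ℝ) • z l - (2⁻¹ ^ l : ℝ) • w)⁺ = 0 := by
  have key : ∀ k l, k < l → (v (k + 1) - (4 ^ k : ℝ) • z k - (2⁻¹ ^ k : ℝ) • w)⁺ ⊓
      (v (l + 1) - (4 ^ l : ℝ) • z l - (2⁻¹ ^ l : ℝ) • w)⁺ = 0 := fun k l hkl => by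
    -- With `c = 2 ^ (k + l + 1)`, `c⁻¹ • v (l + 1) ≤ 2⁻¹ ^ k • w`, while `k < l` gives `c ≤ 4 ^ l`,
    -- so `c • v (k + 1) ≤ 4 ^ l • z l`.
    have hc : (0 : ℝ) < 2 ^ (k + (l + 1)) := by positivity
    have h4 : (2 : ℝ) ^ (k + (l + 1)) ≤ 4 ^ l := by
      rw [show (4 : ℝ) = 2 ^ 2 by norm_num, ← pow_mul]
      exact pow_le_pow_right₀ (by norm_num) (by omega)
    refine inf_eq_zero_of_le (posPart_nonneg _) (posPart_nonneg _) ?_ ?_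
      (posPart_sub_smul_inf_eq_zero (v (k + 1)) (v (l + 1)) hc)
    · refine posPart_mono ?_
      have h1 : 0 ≤ (4 ^ k : ℝ) • z k := smul_nonneg (by positivity) (hz0 k)
      have h2 := smul_le_smul_of_nonneg_left (hv (l + 1)) (show (0 : ℝ) ≤ 2⁻¹ ^ k by positivity)
      rw [smul_smul, ← pow_add, inv_pow] at h2
      exact sub_le_sub (sub_le_self _ h1) h2
    · refine posPart_mono ?_
      have h1 : 0 ≤ (2⁻¹ ^ l : ℝ) • w := smul_nonneg (by positivity) hw
      refine (sub_le_self _ h1).trans (sub_le_sub_left ?_ _)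
      calc (2 ^ (k + (l + 1)) : ℝ) • v (k + 1) ≤ (2 ^ (k + (l + 1)) : ℝ) • z l :=
            smul_le_smul_of_nonneg_left (hz _ _ hkl) hc.le
        _ ≤ (4 ^ l : ℝ) • z l := smul_le_smul_of_nonneg_right h4 (hz0 l)
  intro k l hkl
  rcases lt_or_gt_of_ne hkl with h | h
  · exact key k l h
  · rw [inf_comm]
    exact key l k h

end Disjointification

/-! ### The two substantial implications. -/

section Main

set_option linter.unusedSectionVars false

variable {E : Type*} [NormedAddCommGroup E] [NormedSpace ℝ E] [CompleteSpace E] [Lattice E]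
  [IsOrderedAddMonoid E] [IsOrderedModule ℝ E] [HasSolidNorm E]

/-- If positive weak* null functionals `g n` stay away from zero on a norm bounded positive
sequence `v n`, then along a subsequence they do so on disjoint vectors below `v n`. -/
lemma exists_disjoint_of_le_apply {g : ℕ → StrongDual ℝ E} (hg0 : ∀ n, 0 ≤ g n)
    (hg : WeakStarNull g) {v : ℕ → E} (hv0 : ∀ n, 0 ≤ v n) {C : ℝ} (hC : ∀ n, ‖v n‖ ≤ C)
    {ε : ℝ} (hε : 0 < ε) (hgv : ∀ n, ε ≤ g n (v n)) :
    ∃ ψ : ℕ → ℕ, StrictMono ψ ∧ ∃ u : ℕ → E, (∀ k, 0 ≤ u k) ∧ (∀ k, u k ≤ v (ψ k)) ∧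
      (Pairwise fun k l => u k ⊓ u l = 0) ∧ ∀ᶠ k in atTop, ε / 2 ≤ g (ψ k) (u k) := by
  rw [weakStarNull_iff] at hg
  -- `s n` dominates every `v i` with `i ≤ n`; the next index is taken so far out that `g` is tiny
  -- on `4 ^ k • s n`.
  let s : ℕ → E := fun n => ∑ i ∈ Finset.range (n + 1), v i
  have hs0 : ∀ n, 0 ≤ s n := fun n => Finset.sum_nonneg fun i _ => hv0 i
  have hvs : ∀ i n, i ≤ n → v i ≤ s n := fun i n hin =>
    Finset.single_le_sum (fun j _ => hv0 j) (Finset.mem_range_succ_iff.2 hin)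
  have hnext : ∀ k n : ℕ, ∃ m, n < m ∧ g m ((4 ^ k : ℝ) • s n) ≤ 2⁻¹ ^ k := fun k n =>
    ((eventually_gt_atTop n).and
      ((hg ((4 ^ k : ℝ) • s n)).eventually_le_const (by positivity))).exists
  choose N hN hgN using hnext
  let σ : ℕ → ℕ := fun k => Nat.rec 0 (fun k n => N k n) k
  have hσ : StrictMono σ := strictMono_nat_of_lt_succ fun k => hN k (σ k)
  -- Completeness of `E` enters here.
  have hsum : Summable fun k : ℕ => (2⁻¹ ^ k : ℝ) • v (σ k) := by
    refine .of_norm_bounded (g := fun k : ℕ => (2⁻¹ : ℝ) ^ k * C)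
      ((summable_geometric_of_lt_one (by norm_num) (by norm_num)).mul_right C) fun k => ?_
    rw [norm_smul, Real.norm_of_nonneg (by positivity)]
    exact mul_le_mul_of_nonneg_left (hC _) (by positivity)
  let w : E := ∑' k : ℕ, (2⁻¹ ^ k : ℝ) • v (σ k)
  have hterm : ∀ k : ℕ, 0 ≤ (2⁻¹ ^ k : ℝ) • v (σ k) := fun k =>
    smul_nonneg (by positivity) (hv0 _)
  have hw : ∀ k : ℕ, (2⁻¹ ^ k : ℝ) • v (σ k) ≤ w := fun k =>
    hsum.le_tsum k fun j _ => hterm j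
  have hw0 : 0 ≤ w := (hterm 0).trans (hw 0)
  refine ⟨fun k => σ (k + 1), fun k l hkl => hσ (Nat.succ_lt_succ hkl),
    fun k => (v (σ (k + 1)) - (4 ^ k : ℝ) • s (σ k) - (2⁻¹ ^ k : ℝ) • w)⁺,
    fun k => posPart_nonneg _, fun k => ?_, ?_, ?_⟩
  · refine sup_le ?_ (hv0 _)
    exact (sub_le_self _ (smul_nonneg (by positivity) hw0)).trans
      (sub_le_self _ (smul_nonneg (by positivity) (hs0 _)))
  · exact disjoint_posPart_sub (v := fun k => v (σ k)) (z := fun k => s (σ k)) hw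
      (fun k => hs0 _) hw0 fun i k hik => hvs _ _ (hσ.monotone hik)
  · have h2 : Tendsto (fun k : ℕ => (2⁻¹ : ℝ) ^ k) atTop (𝓝 0) :=
      tendsto_pow_atTop_nhds_zero_of_lt_one (by norm_num) (by norm_num)
    have h3 : Tendsto (fun k : ℕ => g (σ (k + 1)) w) atTop (𝓝 0) :=
      (hg w).comp (hσ.tendsto_atTop.comp (tendsto_add_atTop_nat 1))
    -- This bounds what `g` loses when `v` is replaced by `u`; eventually it is at most `ε / 2`.
    have h4 : Tendsto (fun k : ℕ => (2⁻¹ : ℝ) ^ k + 2⁻¹ ^ k * g (σ (k + 1)) w) atTop (𝓝 0) := by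
      simpa using h2.add (h2.mul h3)
    filter_upwards [h4.eventually_le_const (half_pos hε)] with k hk
    have h5 := monotone_apply (hg0 (σ (k + 1)))
      (le_posPart (v (σ (k + 1)) - (4 ^ k : ℝ) • s (σ k) - (2⁻¹ ^ k : ℝ) • w))
    have h6 : g (σ (k + 1)) ((4 ^ k : ℝ) • s (σ k)) ≤ 2⁻¹ ^ k := hgN k (σ k)
    have h7 := hgv (σ (k + 1))
    rw [map_sub, map_sub, map_smul _ _ w, smul_eq_mul] at h5
    linarith

lemma almostLimited_solidClosure (hE : PropertyD E)
    (h : ∀ (x : ℕ → E) (f : ℕ → StrongDual ℝ E),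
      DisjointSeq x → WeaklyNull x → (∀ n, 0 ≤ x n) →
      DisjointSeq f → WeakStarNull f → (∀ n, 0 ≤ f n) →
      Tendsto (fun n => f n (x n)) atTop (𝓝 0))
    {W : Set E} (hW : RelativelyWeaklyCompact W) :
    AlmostLimited (LatticeOrderedAddCommGroup.solidClosure W) := by
  obtain ⟨C, hC⟩ := hW.exists_norm_le
  refine ⟨isBounded_iff_forall_norm_le.2 ⟨C, ?_⟩, fun f hfd hf => ?_⟩
  · rintro y ⟨x, hx, hyx⟩
    exact (norm_le_norm_of_abs_le_abs hyx).trans (hC x hx)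
  rw [Metric.tendstoUniformlyOn_iff]
  by_contra! hcon
  obtain ⟨ε, hε, hfreq⟩ := hcon
  obtain ⟨ψ, hψ, hP⟩ := extraction_of_frequently_atTop (not_eventually.1 hfreq)
  have hP' : ∀ n, ∃ w ∈ W, ε ≤ |f (ψ n)| |w| := fun n => by
    have := hP n
    push Not at this
    obtain ⟨y, ⟨w, hw, hyw⟩, hy⟩ := this
    rw [dist_zero_left, Real.norm_eq_abs] at hy
    exact ⟨w, hw, (hy.trans (abs_apply_le_abs_apply_abs _ _)).trans
      (monotone_apply (abs_nonneg _) hyw)⟩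
  choose w hwW hw using hP'
  -- The only use of property (d).
  have hg := (hE f hfd hf).comp hψ.tendsto_atTop
  obtain ⟨χ, hχ, u, hu0, huw, hud, hlow⟩ := exists_disjoint_of_le_apply
    (fun n => abs_nonneg (f (ψ n))) hg (fun n => abs_nonneg (w n))
    (fun n => (norm_abs_eq_norm (w n)).trans_le (hC _ (hwW n))) hε hw
  have hnull := h u (fun k => |f (ψ (χ k))|) (.of_nonneg hu0 hud)
    (weaklyNull_of_disjoint_of_le_abs hW (w := fun k => w (χ k))
      (fun k => subset_closure (Set.mem_image_of_mem _ (hwW _))) hu0 huw hud) hu0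
    (hfd.abs.comp (hψ.comp hχ).injective) (hg.comp hχ.tendsto_atTop) fun k => abs_nonneg _
  obtain ⟨k, hk1, hk2⟩ := (hlow.and (hnull.eventually_lt_const (half_pos hε))).exists
  exact absurd hk2 (not_lt.2 hk1)

lemma weakDPStar_of_almostLimited_solidClosure
    (h : ∀ W : Set E, RelativelyWeaklyCompact W →
      AlmostLimited (LatticeOrderedAddCommGroup.solidClosure W)) : WeakDPStar E := by
  intro x f hx hfd hf
  have hu := (h _ hx.relativelyWeaklyCompact_range).2 f hfd hf
  rw [Metric.tendstoUniformlyOn_iff] at hu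
  rw [Metric.tendsto_atTop']
  intro ε hε
  obtain ⟨N, hN⟩ := eventually_atTop.1 (hu ε hε)
  refine ⟨N, fun n hn => ?_⟩
  rw [dist_comm]
  exact hN n hn.le (x n) ⟨x n, ⟨n, rfl⟩, le_rfl⟩

end Main

end BanachLattice

end

theorem mainTheorem7 (E : Type*) [NormedAddCommGroup E] [NormedSpace ℝ E] [CompleteSpace E]
    [Lattice E] [IsOrderedAddMonoid E] [IsOrderedModule ℝ E] [HasSolidNorm E]
    (hE : BanachLattice.PropertyD E) :
    List.TFAE [
      BanachLattice.WeakDPStar E,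
      ∀ (x : ℕ → E) (f : ℕ → StrongDual ℝ E),
        BanachLattice.WeaklyNull x → (∀ n, 0 ≤ x n) →
        BanachLattice.DisjointSeq f → BanachLattice.WeakStarNull f →
        Tendsto (fun n => f n (x n)) atTop (𝓝 0),
      ∀ (x : ℕ → E) (f : ℕ → StrongDual ℝ E),
        BanachLattice.DisjointSeq x → BanachLattice.WeaklyNull x →
        BanachLattice.DisjointSeq f → BanachLattice.WeakStarNull f →
        Tendsto (fun n => f n (x n)) atTop (𝓝 0),
      ∀ (x : ℕ → E) (f : ℕ → StrongDual ℝ E),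
        BanachLattice.DisjointSeq x → BanachLattice.WeaklyNull x → (∀ n, 0 ≤ x n) →
        BanachLattice.DisjointSeq f → BanachLattice.WeakStarNull f →
        Tendsto (fun n => f n (x n)) atTop (𝓝 0),
      ∀ W : Set E, BanachLattice.RelativelyWeaklyCompact W →
        BanachLattice.AlmostLimited (LatticeOrderedAddCommGroup.solidClosure W),
      ∀ (x : ℕ → E) (f : ℕ → StrongDual ℝ E),
        BanachLattice.WeaklyNull x → (∀ n, 0 ≤ x n) →
        BanachLattice.DisjointSeq f → BanachLattice.WeakStarNull f → (∀ n, 0 ≤ f n) →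
        Tendsto (fun n => f n (x n)) atTop (𝓝 0),
      ∀ (x : ℕ → E) (f : ℕ → StrongDual ℝ E),
        BanachLattice.DisjointSeq x → BanachLattice.WeaklyNull x → (∀ n, 0 ≤ x n) →
        BanachLattice.DisjointSeq f → BanachLattice.WeakStarNull f → (∀ n, 0 ≤ f n) →
        Tendsto (fun n => f n (x n)) atTop (𝓝 0)] := by
  tfae_have 1 → 2 := fun h x f hx _ => h x f hx
  tfae_have 1 → 3 := fun h x f _ hx => h x f hx
  tfae_have 2 → 6 := fun h x f hx hx0 hfd hf _ => h x f hx hx0 hfd hf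
  tfae_have 6 → 7 := fun h x f _ hx => h x f hx
  tfae_have 3 → 4 := fun h x f hxd hx _ => h x f hxd hx
  tfae_have 4 → 7 := fun h x f hxd hx hx0 hfd hf _ => h x f hxd hx hx0 hfd hf
  tfae_have 7 → 5 := fun h _ hW => BanachLattice.almostLimited_solidClosure hE h hW
  tfae_have 5 → 1 := BanachLattice.weakDPStar_of_almostLimited_solidClosure
  tfae_finish
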